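/- Let $X\subseteq\mathbb R^d$ be Lebesgue measurable, with the $\sigma$-algebra of its Lebesgue measurable subsets, and let $\pi$ be a probability density on $X$ with respect to Lebesgue measure (also write $\pi$ for the corresponding distribution). For a proposal density $q(x,y)$ the Metropolis–Hastings kernel targeting $\pi$ is $$P(x,dy)=q(x,y)\,\alpha(x,y)\,dy+\Big[1-\int_X q(x,z)\,\alpha(x,z)\,dz\Big]\delta_x(dy),\qquad \alpha(x,y)=1\wedge\frac{\pi(y)q(y,x)}{\pi(x)q(x,y)}$$ for $x,y\in X$ (with $\alpha(x,y)=1$ if the denominator vanishes; proposals outside $X$ are rejected). A Markov kernel $P$ on $X$ with stationary distribution $\pi$ is called variance bounding if for every $h\in L^2(\pi)$ the asymptotic variance $$\lim_{n\to\infty} n\,\mathrm{Var}\Big[\frac1n\sum_{i=1}^n h(X_i)\Big]$$ exists and is finite, where $(X_i)_{i\ge1}$ is the Markov chain with kernel $P$ and $X_1\sim\pi$. Let $\lambda,\sigma>0$ and let $v:X\to\mathbb R^d$ be measurable with $\operatorname{ess\,sup}_\pi\|v\|<\infty$ (Euclidean norm). Let $P_{\mathrm{RWM}}$ be the Metropolis–Hastings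 kernel targeting $\pi$ whose proposal from $x$ is the normal distribution $\mathsf N(x,\lambda^2 I)$, that is, $q(x,y)\propto e^{-\|y-x\|^2/(2\lambda^2)}$, and let $P$ be the Metropolis–Hastings kernel targeting $\pi$ whose proposal from $x$ is $\mathsf N(x+v(x),\sigma^2 I)$, that is, $q(x,y)\propto e^{-\|y-x-v(x)\|^2/(2\sigma^2)}$. Then $P_{\mathrm{RWM}}$ is variance bounding if and only if $P$ is variance bounding. -/

import Mathlib

open MeasureTheory ProbabilityTheory Filter Topology
open scoped NNReal ENNReal

noncomputable section

/-! ## Stationary Markov chains, asymptotic variance, variance bounding -/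

section Chains

variable {S : Type*} [MeasurableSpace S]

/-- The law on `ℕ → S` of the time-homogeneous Markov chain `(X₀, X₁, …)` with transition kernel
`P` and `X₀ ∼ π`. -/
def chainLaw (P : Kernel S S) [IsMarkovKernel P] (π : Measure S) : Measure (ℕ → S) :=
  Kernel.trajMeasure (X := fun _ => S) π
    (fun n => P.comap
      (fun x : (Π _ : Finset.Iic n, S) => x ⟨n, Finset.mem_Iic.2 le_rfl⟩)
      (measurable_pi_apply _))

/-- `P` has the finite asymptotic variance `s` for `h`: with `X₀ ∼ π`, the sequence
`n * Var[(1/n) ∑_{i<n} h(X_i)]` converges to the real number `s`. -/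
def HasAsymptoticVariance (P : Kernel S S) [IsMarkovKernel P] (π : Measure S)
    (h : S → ℝ) (s : ℝ) : Prop :=
  Tendsto
    (fun n : ℕ => (n : ℝ) *
      variance (fun ω : ℕ → S => (1 / (n : ℝ)) * ∑ i ∈ Finset.range n, h (ω i)) (chainLaw P π))
    atTop (𝓝 s)

/-- A Markov kernel `P` with stationary distribution `π` is variance bounding if every
`h ∈ L²(π)` has a finite asymptotic variance. -/
def VarianceBounding (P : Kernel S S) [IsMarkovKernel P] (π : Measure S) : Prop :=
  ∀ h : S → ℝ, MemLp h 2 π → ∃ s : ℝ, HasAsymptoticVariance P π h s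

end Chains

/-! ## Metropolis-Hastings kernels with respect to a reference measure -/

section MetropolisHastings

/-- A probability density on `S` with respect to the reference measure `μ`. -/
structure TargetDensity (S : Type*) [MeasurableSpace S] (μ : Measure S) where
  dens : S → ℝ≥0
  measurable_dens : Measurable dens
  lintegral_dens : ∫⁻ x, (dens x : ℝ≥0∞) ∂μ = 1

/-- A proposal density `q(x, y)` on `S` with respect to the reference measure `μ`.  The total
mass of `q(x, ·)` over `S` may be less than one: this happens when `S` is a part of a larger space
in which the proposal is made, and proposals outside `S` are then rejected. -/
structure ProposalDensity (S : Type*) [MeasurableSpace S] (μ : Measure S) where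
  dens : S → S → ℝ≥0
  measurable_dens : Measurable (Function.uncurry dens)
  lintegral_dens_le : ∀ x, ∫⁻ y, (dens x y : ℝ≥0∞) ∂μ ≤ 1

variable {S : Type*} [MeasurableSpace S] {μ : Measure S}

/-- The target distribution, `π(dx) = π(x) μ(dx)`. -/
def TargetDensity.toMeasure (π : TargetDensity S μ) : Measure S :=
  μ.withDensity (fun x => (π.dens x : ℝ≥0∞))

/-- The acceptance probability `1 ∧ π(y)q(y,x) / (π(x)q(x,y))`, with the usual convention that it
is `1` when the denominator vanishes. -/
def mhAccept (π : TargetDensity S μ) (Q : ProposalDensity S μ) (x y : S) : ℝ≥0 :=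
  if π.dens x * Q.dens x y = 0 then 1
  else min 1 (π.dens y * Q.dens y x / (π.dens x * Q.dens x y))

/-- The probability, from `x`, that a move is proposed and accepted. -/
def mhMeanAccept (π : TargetDensity S μ) (Q : ProposalDensity S μ) (x : S) : ℝ≥0∞ :=
  ∫⁻ y, (Q.dens x y : ℝ≥0∞) * (mhAccept π Q x y : ℝ≥0∞) ∂μ

/-- The Metropolis-Hastings kernel
`P(x, dy) = q(x, y) α(x, y) μ(dy) + [1 - ∫ q(x, z) α(x, z) μ(dz)] δ_x(dy)`. -/
def mhKernel [SFinite μ] (π : TargetDensity S μ) (Q : ProposalDensity S μ) : Kernel S S :=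
  Kernel.withDensity (Kernel.const S μ)
      (fun x y => (Q.dens x y : ℝ≥0∞) * (mhAccept π Q x y : ℝ≥0∞))
    + Kernel.withDensity (Kernel.deterministic (id : S → S) measurable_id)
      (fun x _ => 1 - mhMeanAccept π Q x)

theorem measurable_mhAccept (π : TargetDensity S μ) (Q : ProposalDensity S μ) :
    Measurable (fun z : S × S => mhAccept π Q z.1 z.2) := by
  have h1 : Measurable (fun z : S × S => π.dens z.1) := π.measurable_dens.comp measurable_fst
  have h2 : Measurable (fun z : S × S => π.dens z.2) := π.measurable_dens.comp measurable_snd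
  have h3 : Measurable (fun z : S × S => Q.dens z.1 z.2) := Q.measurable_dens
  have h4 : Measurable (fun z : S × S => Q.dens z.2 z.1) :=
    Q.measurable_dens.comp measurable_swap
  unfold mhAccept
  exact Measurable.ite ((h1.mul h3) (measurableSet_singleton 0)) measurable_const
    (measurable_const.min ((h2.mul h4).div (h1.mul h3)))

theorem measurable_mhFlow (π : TargetDensity S μ) (Q : ProposalDensity S μ) :
    Measurable (Function.uncurry
      fun x y => (Q.dens x y : ℝ≥0∞) * (mhAccept π Q x y : ℝ≥0∞)) :=
  (Q.measurable_dens.coe_nnreal_ennreal).mul (measurable_mhAccept π Q).coe_nnreal_ennreal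

theorem measurable_mhMeanAccept [SFinite μ] (π : TargetDensity S μ) (Q : ProposalDensity S μ) :
    Measurable (mhMeanAccept π Q) :=
  (measurable_mhFlow π Q).lintegral_prod_right'

theorem mhAccept_le_one (π : TargetDensity S μ) (Q : ProposalDensity S μ) (x y : S) :
    mhAccept π Q x y ≤ 1 := by
  unfold mhAccept
  split_ifs
  · exact le_rfl
  · exact min_le_left _ _

theorem mhMeanAccept_le_one (π : TargetDensity S μ) (Q : ProposalDensity S μ) (x : S) :
    mhMeanAccept π Q x ≤ 1 := by
  refine le_trans (lintegral_mono fun y => ?_) (Q.lintegral_dens_le x)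
  exact mul_le_of_le_one_right' (ENNReal.coe_le_one_iff.2 (mhAccept_le_one π Q x y))

theorem mhKernel_apply [SFinite μ] (π : TargetDensity S μ) (Q : ProposalDensity S μ) (x : S)
    (A : Set S) :
    mhKernel π Q x A =
      ∫⁻ y in A, (Q.dens x y : ℝ≥0∞) * (mhAccept π Q x y : ℝ≥0∞) ∂μ
        + (1 - mhMeanAccept π Q x) * Measure.dirac x A := by
  have h2 : Measurable (Function.uncurry fun (x _ : S) => 1 - mhMeanAccept π Q x) :=
    (measurable_const.sub (measurable_mhMeanAccept π Q)).comp measurable_fst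
  rw [mhKernel, _root_.add_apply, Measure.add_apply,
    Kernel.withDensity_apply' _ (measurable_mhFlow π Q), Kernel.withDensity_apply' _ h2,
    Kernel.const_apply, Kernel.deterministic_apply, setLIntegral_const, id]

instance [SFinite μ] (π : TargetDensity S μ) (Q : ProposalDensity S μ) :
    IsMarkovKernel (mhKernel π Q) := by
  refine ⟨fun x => ⟨?_⟩⟩
  rw [mhKernel_apply π Q x Set.univ, Measure.restrict_univ, measure_univ, mul_one]
  exact add_tsub_cancel_of_le (mhMeanAccept_le_one π Q x)

end MetropolisHastings

/-! ## Lebesgue measurable subsets of `ℝ^d` and Gaussian proposals -/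

section Gaussian

variable {d : ℕ}

/-- The state space `X ⊆ ℝ^d` with the σ-algebra of all Lebesgue measurable subsets of `X`. -/
abbrev LebesgueSpace (X : Set (EuclideanSpace ℝ (Fin d))) : Type :=
  NullMeasurableSpace X (Measure.comap Subtype.val volume)

/-- The point of `ℝ^d` underlying a state. -/
def LebesgueSpace.pos {X : Set (EuclideanSpace ℝ (Fin d))} (x : LebesgueSpace X) :
    EuclideanSpace ℝ (Fin d) :=
  Subtype.val (p := fun z => z ∈ X) x

/-- Lebesgue measure on `X`. -/
def lebesgueOn (X : Set (EuclideanSpace ℝ (Fin d))) : Measure (LebesgueSpace X) :=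
  (Measure.comap Subtype.val volume : Measure X).completion

theorem LebesgueSpace.measurable_pos {X : Set (EuclideanSpace ℝ (Fin d))} :
    Measurable (LebesgueSpace.pos (X := X)) :=
  fun _ hs => (measurable_subtype_coe hs).nullMeasurableSet

theorem lebesgueOn_preimage_le (X : Set (EuclideanSpace ℝ (Fin d)))
    {s : Set (EuclideanSpace ℝ (Fin d))} (hs : MeasurableSet s) :
    lebesgueOn X (LebesgueSpace.pos ⁻¹' s) ≤ volume s := by
  change (Measure.comap Subtype.val volume : Measure X) (Subtype.val ⁻¹' s) ≤ volume s
  by_cases h : Function.Injective (Subtype.val : X → EuclideanSpace ℝ (Fin d)) ∧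
      ∀ t : Set X, MeasurableSet t → NullMeasurableSet (Subtype.val '' t) volume
  · rw [Measure.comap_apply₀ _ _ h.1 h.2 (measurable_subtype_coe hs).nullMeasurableSet]
    exact measure_mono (Set.image_preimage_subset _ _)
  · rw [Measure.comap, dif_neg h]
    simp

instance (X : Set (EuclideanSpace ℝ (Fin d))) : SigmaFinite (lebesgueOn X) := by
  refine ⟨⟨⟨fun n => LebesgueSpace.pos ⁻¹'
    spanningSets (volume : Measure (EuclideanSpace ℝ (Fin d))) n, fun _ => trivial,
    fun n => ?_, ?_⟩⟩⟩
  · exact (lebesgueOn_preimage_le X (measurableSet_spanningSets _ n)).trans_lt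
      (measure_spanningSets_lt_top _ n)
  · rw [← Set.preimage_iUnion, iUnion_spanningSets, Set.preimage_univ]

/-- The density of the normal distribution `N(m, σ² I)` on `ℝ^d` at `y`. -/
def gaussianDensity (m : EuclideanSpace ℝ (Fin d)) (σ : ℝ) (y : EuclideanSpace ℝ (Fin d)) : ℝ :=
  (2 * Real.pi * σ ^ 2) ^ (-(d : ℝ) / 2) * Real.exp (-(1 / (2 * σ ^ 2)) * ‖y - m‖ ^ 2)

theorem lintegral_gaussianDensity (m : EuclideanSpace ℝ (Fin d)) {σ : ℝ} (hσ : 0 < σ) :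
    ∫⁻ y, ENNReal.ofReal (gaussianDensity m σ y) = 1 := by
  have hb : 0 < 1 / (2 * σ ^ 2) := by positivity
  have h0 := GaussianFourier.integral_rexp_neg_mul_sq_norm
    (V := EuclideanSpace ℝ (Fin d)) hb
  have hpos : 0 < 2 * Real.pi * σ ^ 2 := by positivity
  have hint : ∫ y, gaussianDensity m σ y = 1 := by
    unfold gaussianDensity
    rw [integral_const_mul, integral_sub_right_eq_self
      (fun y : EuclideanSpace ℝ (Fin d) => Real.exp (-(1 / (2 * σ ^ 2)) * ‖y‖ ^ 2)) m, h0,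
      finrank_euclideanSpace_fin,
      show Real.pi / (1 / (2 * σ ^ 2)) = 2 * Real.pi * σ ^ 2 by field_simp,
      ← Real.rpow_add hpos]
    simp [neg_div]
  have hI : Integrable (gaussianDensity (d := d) m σ) := by
    by_contra h
    rw [integral_undef h] at hint
    exact zero_ne_one hint
  rw [← ofReal_integral_eq_lintegral_ofReal hI
    (Eventually.of_forall fun y => by unfold gaussianDensity; positivity), hint,
    ENNReal.ofReal_one]

/-- The proposal from `x ∈ X` is `N(x + v(x), σ² I)` on `ℝ^d`:
`q(x, y) ∝ exp(-‖y - x - v(x)‖² / (2σ²))`. -/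
def gaussianProposal (X : Set (EuclideanSpace ℝ (Fin d)))
    (v : LebesgueSpace X → EuclideanSpace ℝ (Fin d)) (hv : Measurable v)
    (σ : ℝ) (hσ : 0 < σ) : ProposalDensity (LebesgueSpace X) (lebesgueOn X) where
  dens x y := (gaussianDensity (x.pos + v x) σ y.pos).toNNReal
  measurable_dens := by
    have h1 : Measurable (fun z : LebesgueSpace X × LebesgueSpace X =>
        z.2.pos - (z.1.pos + v z.1)) :=
      (LebesgueSpace.measurable_pos.comp measurable_snd).sub
        ((LebesgueSpace.measurable_pos.comp measurable_fst).add (hv.comp measurable_fst))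
    unfold gaussianDensity
    exact (measurable_const.mul
      (Real.measurable_exp.comp (measurable_const.mul (h1.norm.pow_const 2)))).real_toNNReal
  lintegral_dens_le x := by
    have hmap : (lebesgueOn X).map LebesgueSpace.pos ≤ volume :=
      Measure.le_iff.2 fun s hs => by
        rw [Measure.map_apply LebesgueSpace.measurable_pos hs]
        exact lebesgueOn_preimage_le X hs
    have hm : Measurable fun y => ENNReal.ofReal (gaussianDensity (x.pos + v x) σ y) := by
      unfold gaussianDensity
      fun_prop
    calc ∫⁻ y : LebesgueSpace X, ((gaussianDensity (x.pos + v x) σ y.pos).toNNReal : ℝ≥0∞)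
          ∂(lebesgueOn X)
        = ∫⁻ y, ENNReal.ofReal (gaussianDensity (x.pos + v x) σ y)
            ∂((lebesgueOn X).map LebesgueSpace.pos) :=
          (lintegral_map hm LebesgueSpace.measurable_pos).symm
      _ ≤ ∫⁻ y, ENNReal.ofReal (gaussianDensity (x.pos + v x) σ y) :=
          lintegral_mono' hmap le_rfl
      _ = 1 := lintegral_gaussianDensity _ hσ

/-- The Gaussian random walk proposal: from `x ∈ X` the proposal is `N(x, σ² I)`. -/
def rwmProposal (X : Set (EuclideanSpace ℝ (Fin d))) (σ : ℝ) (hσ : 0 < σ) :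
    ProposalDensity (LebesgueSpace X) (lebesgueOn X) :=
  gaussianProposal X (fun _ => 0) measurable_const σ hσ

end Gaussian

end

/-! For a reversible kernel, variance bounding is equivalent to a spectral gap at 1: `1 - P` is
coercive on mean-zero functions, that is, a Poincaré inequality holds between the L² norm and the
Dirichlet form (`varianceBounding_iff_poincareInequality`). Given a gap, Lax–Milgram solves the
Poisson equation g - P g = h, and the variance of the partial sums telescopes. Conversely, finite
asymptotic variances and uniform boundedness make partial sums of length n of order √n ‖f‖,
uniformly in f. A function of tiny Dirichlet form moves too slowly along the chain for that: its
partial sums stay close to n copies of one vector.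

The Dirichlet form of a Metropolis–Hastings kernel sees only accepted moves, whose stationary flow
has the symmetric density min(π(x)q(x,y), π(y)q(y,x)). Domination of one flow by a multiple of
another would transfer the Poincaré inequality, but Gaussian tails with different variances or
drifts need not be comparable. It suffices to compare bounded moves: long moves carry so little flow
that their contribution is at most a fraction of the L² norm and can be absorbed
(`PoincareInequality.of_mhFlow_le`). On bounded moves with bounded drifts, Gaussian densities are
comparable. The argument does not distinguish the two proposals, so
`PoincareInequality.of_gaussianProposal` gives both implications. -/

/-! ### Partial sums and coercivity for abstract stationary chains in Hilbert space -/

section AbstractChain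

variable {E K : Type*} [NormedAddCommGroup E] [InnerProductSpace ℝ E]
  [NormedAddCommGroup K] [InnerProductSpace ℝ K]

/-- Partial sums along an abstract reversible chain of a vector of the form `g - P g`. -/
theorem norm_sq_sum_chain_coboundary {P : E →L[ℝ] E} {U : ℕ → E →L[ℝ] K}
    (hsymm : ∀ f g, inner ℝ (P f) g = inner ℝ f (P g))
    (hU : ∀ i f g, inner ℝ (U i f) (U i g) = inner ℝ f g)
    (hmarkov : ∀ i n f g, i ≤ n → inner ℝ (U i f) (U (n + 1) g) = inner ℝ (U i f) (U n (P g)))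
    (g : E) (n : ℕ) :
    ‖∑ i ∈ Finset.range n, U i (g - P g)‖ ^ 2 =
      n * (‖g - P g‖ ^ 2 + 2 * inner ℝ g (P (g - P g))) - 2 * inner ℝ g (P g)
        + 2 * inner ℝ g ((P ^ (n + 1)) g) := by
  -- The Markov property turns the terms into ⟨g - P g, P^(n-i) f⟩, and by symmetry of `P` these
  -- telescope in i.
  have key : ∀ n f, inner ℝ (∑ i ∈ Finset.range n, U i (g - P g)) (U n f)
      = inner ℝ g (P f - (P ^ (n + 1)) f) := by
    intro n
    induction n with
    | zero => intro f; simp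
    | succ n ih =>
      intro f
      have h1 : inner ℝ (∑ i ∈ Finset.range (n + 1), U i (g - P g)) (U (n + 1) f)
          = inner ℝ (∑ i ∈ Finset.range (n + 1), U i (g - P g)) (U n (P f)) := by
        rw [sum_inner, sum_inner]
        refine Finset.sum_congr rfl fun i hi => hmarkov i n _ _ ?_
        have := Finset.mem_range.1 hi
        omega
      rw [h1, Finset.sum_range_succ, inner_add_left, ih, hU, inner_sub_left, hsymm,
        pow_succ P (n + 1)]
      simp only [inner_sub_right, mul_apply_eq_comp]
      ring
  induction n with
  | zero => simp
  | succ n ih =>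
    rw [Finset.sum_range_succ, norm_add_sq_real, ih, key]
    have h2 : ‖U n (g - P g)‖ ^ 2 = ‖g - P g‖ ^ 2 := by
      rw [← real_inner_self_eq_norm_sq, ← real_inner_self_eq_norm_sq, hU]
    rw [h2, pow_succ P (n + 1)]
    simp only [inner_sub_right, mul_apply_eq_comp, map_sub]
    push_cast
    ring

/-- If `1 - P` is coercive, the normalized second moments of the partial sums along an abstract
reversible chain converge. -/
theorem tendsto_norm_sq_sum_chain_div [CompleteSpace E] {P : E →L[ℝ] E} {U : ℕ → E →L[ℝ] K}
    (hsymm : ∀ f g, inner ℝ (P f) g = inner ℝ f (P g))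
    (hU : ∀ i f g, inner ℝ (U i f) (U i g) = inner ℝ f g)
    (hmarkov : ∀ i n f g, i ≤ n → inner ℝ (U i f) (U (n + 1) g) = inner ℝ (U i f) (U n (P g)))
    (hcontr : ∀ f, ‖P f‖ ≤ ‖f‖)
    {c : ℝ} (hc : 0 < c) (hgap : ∀ f, c * ‖f‖ ^ 2 ≤ inner ℝ (f - P f) f) (h : E) :
    ∃ s : ℝ, Tendsto (fun n : ℕ => ‖∑ i ∈ Finset.range n, U i h‖ ^ 2 / n) atTop (𝓝 s) := by
  obtain ⟨g, rfl⟩ : ∃ g, g - P g = h := by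
    -- Lax–Milgram for the form ⟨f - P f, w⟩ solves the Poisson equation.
    let B : E →L[ℝ] E →L[ℝ] ℝ := (innerSL ℝ).comp (ContinuousLinearMap.id ℝ E - P)
    have hB : IsCoercive B := ⟨c, hc, fun f => by
      have := hgap f
      rw [pow_two, ← mul_assoc] at this
      exact this⟩
    refine ⟨hB.continuousLinearEquivOfBilin.symm h, ?_⟩
    rw [hB.unique_continuousLinearEquivOfBilin (v := hB.continuousLinearEquivOfBilin.symm h)
      (f := hB.continuousLinearEquivOfBilin.symm h - P (hB.continuousLinearEquivOfBilin.symm h))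
      fun w => rfl]
    exact hB.continuousLinearEquivOfBilin.apply_symm_apply h
  -- The coefficient of n in the exact formula; the remaining terms are bounded by 4‖g‖² because `P`
  -- is a contraction.
  set s := ‖g - P g‖ ^ 2 + 2 * inner ℝ g (P (g - P g)) with hs
  refine ⟨s, ?_⟩
  have hpow : ∀ n, ‖(P ^ n) g‖ ≤ ‖g‖ := by
    intro n
    induction n with
    | zero => simp
    | succ n ih =>
      rw [pow_succ', mul_apply_eq_comp]
      exact (hcontr _).trans ih
  have hlim : Tendsto (fun n : ℕ =>
      s + (2 * inner ℝ g ((P ^ (n + 1)) g) - 2 * inner ℝ g (P g)) / n) atTop (𝓝 (s + 0)) := by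
    refine tendsto_const_nhds.add ?_
    refine squeeze_zero_norm (a := fun n : ℕ => 4 * ‖g‖ ^ 2 / n) (fun n => ?_)
      (tendsto_const_div_atTop_nhds_zero_nat _)
    rw [norm_div, Real.norm_natCast]
    gcongr
    have h1 : |inner ℝ g ((P ^ (n + 1)) g)| ≤ ‖g‖ * ‖g‖ :=
      (abs_real_inner_le_norm _ _).trans (by gcongr; exact hpow _)
    have h2 : |inner ℝ g (P g)| ≤ ‖g‖ * ‖g‖ :=
      (abs_real_inner_le_norm _ _).trans (by gcongr; exact hcontr _)
    rw [Real.norm_eq_abs, abs_le]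
    rw [abs_le] at h1 h2
    constructor <;> nlinarith
  rw [add_zero] at hlim
  refine hlim.congr' ?_
  filter_upwards [eventually_gt_atTop 0] with n hn
  have hn' : (n : ℝ) ≠ 0 := by positivity
  rw [norm_sq_sum_chain_coboundary hsymm hU hmarkov, ← hs]
  field_simp
  ring

/-- If the second moments of the partial sums along an abstract stationary chain grow at most
linearly, then `1 - P` is coercive. -/
theorem exists_gap_of_norm_sq_sum_chain_le [CompleteSpace E] {P : E →L[ℝ] E} {U : ℕ → E →L[ℝ] K}
    (hU : ∀ i f g, inner ℝ (U i f) (U i g) = inner ℝ f g)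
    (hmarkov : ∀ i n f g, i ≤ n → inner ℝ (U i f) (U (n + 1) g) = inner ℝ (U i f) (U n (P g)))
    (hbdd : ∀ f, ∃ C : ℝ, ∀ n : ℕ, ‖∑ i ∈ Finset.range n, U i f‖ ^ 2 / n ≤ C) :
    ∃ c : ℝ, 0 < c ∧ ∀ f, c * ‖f‖ ^ 2 ≤ inner ℝ (f - P f) f := by
  -- Uniform boundedness replaces the constants depending on f by a single operator bound.
  obtain ⟨C, hC⟩ : ∃ C, ∀ n : ℕ,
      ‖(Real.sqrt n)⁻¹ • ∑ i ∈ Finset.range n, U i‖ ≤ C := by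
    refine banach_steinhaus fun f => ?_
    obtain ⟨C, hC⟩ := hbdd f
    refine ⟨Real.sqrt C, fun n => Real.le_sqrt_of_sq_le ((le_of_eq ?_).trans (hC n))⟩
    rw [smul_apply, norm_smul, mul_pow, norm_inv, Real.norm_eq_abs, inv_pow,
      sq_abs, Real.sq_sqrt (Nat.cast_nonneg n), sum_apply]
    ring
  obtain ⟨m, hm⟩ := exists_nat_gt (2 * |C|)
  have hm0 : (0 : ℝ) < m := (by positivity : (0 : ℝ) ≤ 2 * |C|).trans_lt hm
  -- The constant comes from squaring the final estimate ‖f‖ ≤ 2m²√(2ε).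
  refine ⟨1 / (8 * (m : ℝ) ^ 4), by positivity, fun f => ?_⟩
  set ε : ℝ := inner ℝ (f - P f) f with hε
  -- Each step moves the vector by exactly √(2ε), so for small ε the sum is nearly a multiple of `U
  -- 0 f`.
  have hstep : ∀ i, ‖U (i + 1) f - U i f‖ ^ 2 = 2 * ε := by
    intro i
    have h1 : inner ℝ (U (i + 1) f) (U i f) = inner ℝ f (P f) := by
      rw [real_inner_comm, hmarkov i i f f le_rfl, hU]
    have h2 : ∀ i, ‖U i f‖ ^ 2 = ‖f‖ ^ 2 := fun i => by
      rw [← real_inner_self_eq_norm_sq, ← real_inner_self_eq_norm_sq, hU]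
    rw [norm_sub_sq_real, h1, h2, h2, hε, inner_sub_left, real_inner_self_eq_norm_sq,
      real_inner_comm]
    ring
  have hε0 : 0 ≤ 2 * ε := by rw [← hstep 0]; positivity
  have hdist : ∀ i : ℕ, ‖U i f - U 0 f‖ ≤ i * Real.sqrt (2 * ε) := by
    intro i
    induction i with
    | zero => simp
    | succ i ih =>
      have h1 : ‖U (i + 1) f - U i f‖ = Real.sqrt (2 * ε) := by
        rw [← hstep i, Real.sqrt_sq (norm_nonneg _)]
      calc ‖U (i + 1) f - U 0 f‖ ≤ ‖U (i + 1) f - U i f‖ + ‖U i f - U 0 f‖ :=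
            norm_sub_le_norm_sub_add_norm_sub _ _ _
        _ ≤ Real.sqrt (2 * ε) + i * Real.sqrt (2 * ε) := by rw [h1]; gcongr
        _ = _ := by push_cast; ring
  have hU0 : ‖U 0 f‖ = ‖f‖ := by
    rw [← sq_eq_sq₀ (norm_nonneg _) (norm_nonneg _), ← real_inner_self_eq_norm_sq,
      ← real_inner_self_eq_norm_sq, hU]
  -- with `N = m ^ 2` summands the upper bound on the sum is at most `N * ‖f‖ / 2`
  set N : ℕ := m ^ 2 with hN
  have hup : ‖∑ i ∈ Finset.range N, U i f‖ ≤ m * |C| * ‖f‖ := by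
    have h1 := (ContinuousLinearMap.le_opNorm
      ((Real.sqrt N)⁻¹ • ∑ i ∈ Finset.range N, U i) f).trans
      (mul_le_mul_of_nonneg_right ((hC N).trans (le_abs_self C)) (norm_nonneg f))
    have hsq : Real.sqrt N = m := by
      rw [hN]; push_cast; exact Real.sqrt_sq hm0.le
    rw [hsq, smul_apply, norm_smul, norm_inv, Real.norm_natCast,
      sum_apply, inv_mul_le_iff₀ hm0] at h1
    linarith
  have hlow : (N : ℝ) * ‖f‖ ≤ ‖∑ i ∈ Finset.range N, U i f‖ + N * (N * Real.sqrt (2 * ε)) := by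
    have h1 : (N : ℝ) • U 0 f = ∑ i ∈ Finset.range N, U i f
        - ∑ i ∈ Finset.range N, (U i f - U 0 f) := by
      rw [Finset.sum_sub_distrib, sub_sub_cancel, Finset.sum_const, Finset.card_range,
        Nat.cast_smul_eq_nsmul]
    have h2 : ‖(N : ℝ) • U 0 f‖ = N * ‖f‖ := by rw [norm_smul, Real.norm_natCast, hU0]
    rw [← h2, h1]
    refine (norm_sub_le _ _).trans (by
      gcongr
      refine (norm_sum_le _ _).trans ?_
      calc ∑ i ∈ Finset.range N, ‖U i f - U 0 f‖
          ≤ ∑ i ∈ Finset.range N, (N * Real.sqrt (2 * ε)) := by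
            refine Finset.sum_le_sum fun i hi => (hdist i).trans ?_
            gcongr
            exact (Finset.mem_range.1 hi).le
        _ = _ := by simp)
  have hNr : (N : ℝ) = (m : ℝ) ^ 2 := by rw [hN]; push_cast; rfl
  rw [hNr] at hlow
  have h3 : ‖f‖ ≤ 2 * m ^ 2 * Real.sqrt (2 * ε) := by
    have : (m : ℝ) ^ 2 * ‖f‖ ≤ (m : ℝ) ^ 2 * (2 * m ^ 2 * Real.sqrt (2 * ε)) := by
      nlinarith [norm_nonneg f, mul_nonneg (mul_nonneg hm0.le (sub_nonneg.2 hm.le)) (norm_nonneg f)]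
    exact le_of_mul_le_mul_left this (by positivity)
  have h4 : ‖f‖ ^ 2 ≤ 8 * (m : ℝ) ^ 4 * ε := by
    calc ‖f‖ ^ 2 ≤ (2 * m ^ 2 * Real.sqrt (2 * ε)) ^ 2 := by gcongr
      _ = 8 * (m : ℝ) ^ 4 * ε := by rw [mul_pow, Real.sq_sqrt hε0]; ring
  rw [one_div, inv_mul_le_iff₀ (by positivity)]
  exact h4

end AbstractChain

/-! ### The Markov operator on L²(π) -/

section MarkovOperator

variable {S : Type*} [MeasurableSpace S] {P : Kernel S S} [IsMarkovKernel P]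
  {π : Measure S} [IsProbabilityMeasure π]

theorem eLpNorm_two_sq_eq_lintegral {Ω : Type*} [MeasurableSpace Ω] (μ : Measure Ω) (f : Ω → ℝ) :
    eLpNorm f 2 μ ^ 2 = ∫⁻ x, ‖f x‖ₑ ^ 2 ∂μ := by
  have := eLpNorm_nnreal_pow_eq_lintegral (μ := μ) (f := f) (p := 2) two_ne_zero
  simpa using this

/-- The L¹ norm is at most the L² norm under each probability measure `P x`; invariance then
integrates the bound back to π. -/
theorem eLpNorm_integral_kernel_le (hinv : P.Invariant π) {g : S → ℝ} (hg : MemLp g 2 π) :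
    eLpNorm (fun x => ∫ y, g y ∂P x) 2 π ≤ eLpNorm g 2 π := by
  have hg' : AEStronglyMeasurable g (P ∘ₘ π) := by rw [hinv.def]; exact hg.1
  have hcomp : ∫⁻ y, ‖g y‖ₑ ^ 2 ∂π = ∫⁻ x, ∫⁻ y, ‖g y‖ₑ ^ 2 ∂P x ∂π := by
    conv_lhs => rw [← hinv.def]
    exact Measure.lintegral_bind P.aemeasurable (hg'.enorm.pow_const 2)
  refine (ENNReal.pow_le_pow_left_iff two_ne_zero).1 ?_
  rw [eLpNorm_two_sq_eq_lintegral,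
    eLpNorm_two_sq_eq_lintegral, hcomp]
  have hmk : ∀ᵐ x ∂π, g =ᵐ[P x] hg'.mk g := Measure.ae_ae_of_ae_comp hg'.ae_eq_mk
  refine lintegral_mono_ae ?_
  filter_upwards [hmk] with x hx
  have hgx : AEStronglyMeasurable g (P x) := ⟨_, hg'.stronglyMeasurable_mk, hx⟩
  calc ‖∫ y, g y ∂P x‖ₑ ^ 2 ≤ (∫⁻ y, ‖g y‖ₑ ∂P x) ^ 2 := by
        gcongr
        exact enorm_integral_le_lintegral_enorm _
    _ = eLpNorm g 1 (P x) ^ 2 := by rw [eLpNorm_one_eq_lintegral_enorm]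
    _ ≤ eLpNorm g 2 (P x) ^ 2 := by
        gcongr
        exact eLpNorm_le_eLpNorm_of_exponent_le (by norm_num) hgx
    _ = _ := eLpNorm_two_sq_eq_lintegral _ _

theorem memLp_integral_kernel (hinv : P.Invariant π) {g : S → ℝ} (hg : MemLp g 2 π) :
    MemLp (fun x => ∫ y, g y ∂P x) 2 π := by
  refine ⟨?_, (eLpNorm_integral_kernel_le hinv hg).trans_lt hg.2⟩
  have hg' : AEStronglyMeasurable g (P ∘ₘ π) := by rw [hinv.def]; exact hg.1
  refine ⟨fun x => ∫ y, hg'.mk g y ∂P x, hg'.stronglyMeasurable_mk.integral_kernel, ?_⟩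
  filter_upwards [Measure.ae_ae_of_ae_comp hg'.ae_eq_mk] with x hx using integral_congr_ae hx

theorem ae_integrable_kernel (hinv : P.Invariant π) {g : S → ℝ} (hg : MemLp g 2 π) :
    ∀ᵐ x ∂π, Integrable g (P x) := by
  refine Measure.ae_integrable_of_integrable_comp ?_
  rw [hinv.def]
  exact hg.integrable (by norm_num)

theorem ae_ae_kernel (hinv : P.Invariant π) {p : S → Prop} (hp : ∀ᵐ y ∂π, p y) :
    ∀ᵐ x ∂π, ∀ᵐ y ∂P x, p y :=
  Measure.ae_ae_of_ae_comp (by rw [hinv.def]; exact hp)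

/-- The operator `g ↦ ∫ g(y) P(·, dy)` on `L²(π)`, for an invariant probability measure `π`. -/
noncomputable def markovOperator (hinv : P.Invariant π) : Lp ℝ 2 π →L[ℝ] Lp ℝ 2 π :=
  LinearMap.mkContinuous
    { toFun := fun g => (memLp_integral_kernel hinv (Lp.memLp g)).toLp _
      map_add' := fun f g => by
        rw [← MemLp.toLp_add]
        refine MemLp.toLp_congr _ _ ?_
        filter_upwards [ae_integrable_kernel hinv (Lp.memLp f),
          ae_integrable_kernel hinv (Lp.memLp g), ae_ae_kernel hinv (Lp.coeFn_add f g)]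
          with x hf hg hfg
        rw [integral_congr_ae hfg]
        exact integral_add hf hg
      map_smul' := fun c g => by
        rw [RingHom.id_apply, ← MemLp.toLp_const_smul]
        refine MemLp.toLp_congr _ _ ?_
        filter_upwards [ae_ae_kernel hinv (Lp.coeFn_smul c g)] with x hg
        rw [integral_congr_ae hg]
        exact integral_smul c _ }
    1 fun g => by
      rw [one_mul, LinearMap.coe_mk, AddHom.coe_mk, Lp.norm_toLp, Lp.norm_def]
      exact ENNReal.toReal_mono (Lp.memLp g).2.ne (eLpNorm_integral_kernel_le hinv (Lp.memLp g))

theorem coeFn_markovOperator (hinv : P.Invariant π) (g : Lp ℝ 2 π) :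
    markovOperator hinv g =ᵐ[π] fun x => ∫ y, g y ∂P x :=
  MemLp.coeFn_toLp (memLp_integral_kernel hinv (Lp.memLp g))

theorem norm_markovOperator_apply_le (hinv : P.Invariant π) (g : Lp ℝ 2 π) :
    ‖markovOperator hinv g‖ ≤ ‖g‖ := by
  have h := (markovOperator hinv).le_of_opNorm_le (LinearMap.mkContinuous_norm_le _ zero_le_one _) g
  rwa [one_mul] at h

theorem measurePreserving_fst_compProd :
    MeasurePreserving Prod.fst (π ⊗ₘ P) π :=
  ⟨measurable_fst, Measure.fst_compProd π P⟩

theorem measurePreserving_snd_compProd (hinv : P.Invariant π) :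
    MeasurePreserving Prod.snd (π ⊗ₘ P) π :=
  ⟨measurable_snd, (Measure.snd_compProd π P).trans hinv.def⟩

theorem inner_markovOperator (hinv : P.Invariant π) (f g : Lp ℝ 2 π) :
    inner ℝ f (markovOperator hinv g) = ∫ z, f z.1 * g z.2 ∂(π ⊗ₘ P) := by
  have hint : Integrable (fun z : S × S => f z.1 * g z.2) (π ⊗ₘ P) :=
    ((Lp.memLp f).comp_measurePreserving measurePreserving_fst_compProd).integrable_mul
      ((Lp.memLp g).comp_measurePreserving (measurePreserving_snd_compProd hinv))
  rw [Measure.integral_compProd hint, L2.inner_def]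
  refine integral_congr_ae ?_
  filter_upwards [coeFn_markovOperator hinv g] with x hx
  rw [hx, integral_const_mul]
  simp [mul_comm]

/-- As an integral over pairs, ⟨f, P g⟩ is symmetric because the law of a stationary pair is
exchangeable. -/
theorem markovOperator_symm (hinv : P.Invariant π)
    (hrev : (π ⊗ₘ P).map Prod.swap = π ⊗ₘ P) (f g : Lp ℝ 2 π) :
    inner ℝ (markovOperator hinv f) g = inner ℝ f (markovOperator hinv g) := by
  rw [real_inner_comm, inner_markovOperator, inner_markovOperator]
  conv_lhs => rw [← hrev]
  rw [integral_map measurable_swap.aemeasurable]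
  · simp [mul_comm]
  · exact ((((Lp.stronglyMeasurable g).measurable.comp measurable_fst).mul
      ((Lp.stronglyMeasurable f).measurable.comp measurable_snd))).aestronglyMeasurable

/-- Needed for mean-zero functions to form a subspace stable under the operator. -/
theorem integral_markovOperator (hinv : P.Invariant π) (g : Lp ℝ 2 π) :
    ∫ x, markovOperator hinv g x ∂π = ∫ x, g x ∂π := by
  have h2 := measurePreserving_snd_compProd hinv
  have hint : Integrable (fun z : S × S => g z.2) (π ⊗ₘ P) :=
    ((Lp.memLp g).comp_measurePreserving h2).integrable (by norm_num)
  rw [integral_congr_ae (coeFn_markovOperator hinv g), ← Measure.integral_compProd hint,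
    ← integral_map (φ := Prod.snd) measurable_snd.aemeasurable
      (by rw [h2.map_eq]; exact (Lp.memLp g).1), h2.map_eq]

end MarkovOperator

/-! ### Stationarity and the Markov property on path space -/

section ChainLaw

variable {S : Type*} [MeasurableSpace S] {P : Kernel S S} [IsMarkovKernel P]
  {π : Measure S} [IsProbabilityMeasure π]

instance : IsProbabilityMeasure (chainLaw P π) := by
  unfold chainLaw; infer_instance

theorem map_eval_zero_chainLaw : (chainLaw P π).map (fun ω => ω 0) = π := by
  have h : (fun ω : ℕ → S => ω 0) =
      (fun x : (Π _ : Finset.Iic 0, S) => x ⟨0, Finset.mem_Iic.2 le_rfl⟩) ∘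
        Preorder.frestrictLe (π := fun _ => S) 0 := rfl
  rw [h, ← Measure.map_map (by fun_prop) (by fun_prop), chainLaw, Kernel.trajMeasure,
    Measure.map_comp _ _ (by fun_prop), Kernel.traj_map_frestrictLe, Kernel.partialTraj_self,
    Measure.id_comp, Measure.map_map (by fun_prop) (by fun_prop)]
  exact Measure.map_id

/-- One step of the chain, jointly with its past. -/
theorem map_frestrictLe_chainLaw_compProd (n : ℕ) :
    (chainLaw P π).map (Preorder.frestrictLe (π := fun _ => S) n) ⊗ₘ
      (P.comap (fun x : (Π _ : Finset.Iic n, S) => x ⟨n, Finset.mem_Iic.2 le_rfl⟩)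
        (measurable_pi_apply _)) =
      (chainLaw P π).map (fun ω => (Preorder.frestrictLe (π := fun _ => S) n ω, ω (n + 1))) :=
  Kernel.map_frestrictLe_trajMeasure_compProd_eq_map_trajMeasure

theorem lintegral_chainLaw_pair (n : ℕ) {F : S × S → ℝ≥0∞} (hF : Measurable F) :
    ∫⁻ ω, F (ω n, ω (n + 1)) ∂chainLaw P π =
      ∫⁻ ω, ∫⁻ y, F (ω n, y) ∂P (ω n) ∂chainLaw P π := by
  have hr : Measurable (Preorder.frestrictLe (π := fun _ => S) n) := by fun_prop
  let G : (Π _ : Finset.Iic n, S) × S → ℝ≥0∞ :=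
    fun z => F (z.1 ⟨n, Finset.mem_Iic.2 le_rfl⟩, z.2)
  have hG : Measurable G := by fun_prop
  have h := congrArg (fun μ => ∫⁻ z, G z ∂μ) (map_frestrictLe_chainLaw_compProd (P := P) (π := π) n)
  have : IsProbabilityMeasure ((chainLaw P π).map (Preorder.frestrictLe (π := fun _ => S) n)) :=
    Measure.isProbabilityMeasure_map hr.aemeasurable
  beta_reduce at h
  rw [Measure.lintegral_compProd hG, lintegral_map hG.lintegral_kernel_prod_right' hr,
    lintegral_map hG (by fun_prop)] at h
  exact h.symm

theorem measurePreserving_eval_chainLaw (hinv : P.Invariant π) (n : ℕ) :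
    MeasurePreserving (fun ω : ℕ → S => ω n) (chainLaw P π) π := by
  induction n with
  | zero => exact ⟨by fun_prop, map_eval_zero_chainLaw⟩
  | succ n ih =>
    refine ⟨by fun_prop, ?_⟩
    ext s hs
    have h := lintegral_chainLaw_pair (P := P) (π := π) n
      (F := fun z => s.indicator 1 z.2) ((measurable_one.indicator hs).comp measurable_snd)
    rw [← lintegral_indicator_one hs, ← lintegral_indicator_one hs,
      lintegral_map (measurable_one.indicator hs) (by fun_prop), h]
    simp only [lintegral_indicator_one hs]
    rw [ih.lintegral_comp (f := fun x => P x s) (P.measurable_coe hs)]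
    conv_rhs => rw [← hinv.def]
    exact (Measure.bind_apply hs P.aemeasurable).symm

theorem measurePreserving_pair_chainLaw (hinv : P.Invariant π) (n : ℕ) :
    MeasurePreserving (fun ω : ℕ → S => (ω n, ω (n + 1))) (chainLaw P π) (π ⊗ₘ P) := by
  refine ⟨by fun_prop, ?_⟩
  ext s hs
  have h := lintegral_chainLaw_pair (P := P) (π := π) n (F := s.indicator 1)
    (measurable_one.indicator hs)
  have hm : Measurable (fun x => ∫⁻ y, s.indicator (1 : S × S → ℝ≥0∞) (x, y) ∂P x) :=
    (measurable_one.indicator hs).lintegral_kernel_prod_right'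
  rw [← lintegral_indicator_one hs, ← lintegral_indicator_one hs,
    lintegral_map (measurable_one.indicator hs) (by fun_prop), h,
    Measure.lintegral_compProd (measurable_one.indicator hs),
    (measurePreserving_eval_chainLaw hinv n).lintegral_comp hm]

/-- Evaluation at time `n`, as an isometry from `L²(π)` to `L²` of the path space. -/
noncomputable def evalL2 (hinv : P.Invariant π) (n : ℕ) : Lp ℝ 2 π →L[ℝ] Lp ℝ 2 (chainLaw P π) :=
  (Lp.compMeasurePreservingₗᵢ ℝ _ (measurePreserving_eval_chainLaw hinv n)).toContinuousLinearMap

theorem coeFn_evalL2 (hinv : P.Invariant π) (n : ℕ) (f : Lp ℝ 2 π) :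
    evalL2 hinv n f =ᵐ[chainLaw P π] fun ω => f (ω n) :=
  Lp.coeFn_compMeasurePreserving f (measurePreserving_eval_chainLaw hinv n)

theorem inner_evalL2_evalL2 (hinv : P.Invariant π) (n : ℕ) (f g : Lp ℝ 2 π) :
    inner ℝ (evalL2 hinv n f) (evalL2 hinv n g) = inner ℝ f g :=
  LinearIsometry.inner_map_map _ f g

theorem inner_evalL2 (hinv : P.Invariant π) (i j : ℕ) (f g : Lp ℝ 2 π) :
    inner ℝ (evalL2 hinv i f) (evalL2 hinv j g) = ∫ ω, f (ω i) * g (ω j) ∂chainLaw P π := by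
  rw [L2.inner_def]
  refine integral_congr_ae ?_
  filter_upwards [coeFn_evalL2 hinv i f, coeFn_evalL2 hinv j g] with ω h1 h2
  rw [h1, h2]
  simp [mul_comm]

/-- Conditioning on the past up to time n replaces g(X_{n+1}) by (P g)(X_n), and f(X_i) is
determined by that past. -/
theorem inner_evalL2_succ (hinv : P.Invariant π) {i n : ℕ} (hi : i ≤ n) (f g : Lp ℝ 2 π) :
    inner ℝ (evalL2 hinv i f) (evalL2 hinv (n + 1) g) =
      inner ℝ (evalL2 hinv i f) (evalL2 hinv n (markovOperator hinv g)) := by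
  rw [inner_evalL2, inner_evalL2]
  have hr : Measurable (Preorder.frestrictLe (π := fun _ => S) n) := by fun_prop
  have hf := (Lp.stronglyMeasurable f).measurable
  have hg := (Lp.stronglyMeasurable g).measurable
  let G : (Π _ : Finset.Iic n, S) × S → ℝ := fun z => f (z.1 ⟨i, Finset.mem_Iic.2 hi⟩) * g z.2
  have hG : Measurable G := by fun_prop
  have h := map_frestrictLe_chainLaw_compProd (P := P) (π := π) n
  have : IsProbabilityMeasure ((chainLaw P π).map (Preorder.frestrictLe (π := fun _ => S) n)) :=
    Measure.isProbabilityMeasure_map hr.aemeasurable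
  have hpair : Measurable fun ω : ℕ → S =>
      (Preorder.frestrictLe (π := fun _ => S) n ω, ω (n + 1)) := by fun_prop
  have hint0 : Integrable (fun ω : ℕ → S => f (ω i) * g (ω (n + 1))) (chainLaw P π) :=
    ((Lp.memLp f).comp_measurePreserving (measurePreserving_eval_chainLaw hinv i)).integrable_mul
      ((Lp.memLp g).comp_measurePreserving (measurePreserving_eval_chainLaw hinv (n + 1)))
  have hint : Integrable G ((chainLaw P π).map (fun ω =>
      (Preorder.frestrictLe (π := fun _ => S) n ω, ω (n + 1)))) :=
    (integrable_map_measure hG.aestronglyMeasurable hpair.aemeasurable).2 hint0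
  have h1 : ∫ ω, f (ω i) * g (ω (n + 1)) ∂chainLaw P π = ∫ z, G z ∂((chainLaw P π).map (fun ω =>
      (Preorder.frestrictLe (π := fun _ => S) n ω, ω (n + 1)))) :=
    (integral_map hpair.aemeasurable hG.aestronglyMeasurable).symm
  rw [h1, ← h]
  rw [← h] at hint
  rw [Measure.integral_compProd hint, integral_map hr.aemeasurable
    hG.stronglyMeasurable.integral_kernel_prod_right'.aestronglyMeasurable]
  refine integral_congr_ae ?_
  -- The operator is known only π-almost everywhere, which is enough since X_n has law π.
  filter_upwards [(measurePreserving_eval_chainLaw hinv n).quasiMeasurePreserving.ae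
    (coeFn_markovOperator hinv g)] with ω hω
  rw [hω]
  exact (integral_const_mul (f (ω i)) fun y => g y).trans rfl

end ChainLaw

/-! ### Variance bounding, spectral gap and Poincaré inequality -/

section SpectralGap

variable {S : Type*} [MeasurableSpace S] {P : Kernel S S} [IsMarkovKernel P]
  {π : Measure S} [IsProbabilityMeasure π]

/-- A measure `ρ` on pairs (the law of one step of a stationary reversible chain, or its
off-diagonal part) satisfies a Poincaré inequality with respect to `π`. -/
def PoincareInequality (ρ : Measure (S × S)) (π : Measure S) : Prop :=
  ∃ c : ℝ≥0, 0 < c ∧ ∀ f : S → ℝ, Measurable f → MemLp f 2 π → ∫ x, f x ∂π = 0 →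
    c * ∫⁻ x, ‖f x‖ₑ ^ 2 ∂π ≤ ∫⁻ z, ‖f z.1 - f z.2‖ₑ ^ 2 ∂ρ

theorem lintegral_enorm_sq_coeFn {Ω : Type*} [MeasurableSpace Ω] {μ : Measure Ω}
    (f : Lp ℝ 2 μ) : ∫⁻ x, ‖f x‖ₑ ^ 2 ∂μ = ENNReal.ofReal (‖f‖ ^ 2) := by
  rw [← eLpNorm_two_sq_eq_lintegral, ← Lp.enorm_def, ← ofReal_norm,
    ENNReal.ofReal_pow (norm_nonneg _)]

/-- The left side is the squared L² distance of f(X_0) and f(X_1) on path space: both have norm ‖f‖,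
and their inner product is ⟨f, P f⟩. -/
theorem lintegral_enorm_sq_sub_compProd (hinv : P.Invariant π) (f : Lp ℝ 2 π) :
    ∫⁻ z, ‖f z.1 - f z.2‖ₑ ^ 2 ∂(π ⊗ₘ P) =
      ENNReal.ofReal (2 * inner ℝ (f - markovOperator hinv f) f) := by
  have hf := (Lp.stronglyMeasurable f).measurable
  have hm : Measurable fun z : S × S => ‖f z.1 - f z.2‖ₑ ^ 2 := by fun_prop
  rw [← (measurePreserving_pair_chainLaw hinv 0).lintegral_comp hm]
  have h1 : ∫⁻ ω, ‖f (ω 0) - f (ω (0 + 1))‖ₑ ^ 2 ∂chainLaw P π =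
      ∫⁻ ω, ‖(evalL2 hinv 0 f - evalL2 hinv (0 + 1) f) ω‖ₑ ^ 2 ∂chainLaw P π := by
    refine lintegral_congr_ae ?_
    filter_upwards [coeFn_evalL2 hinv 0 f, coeFn_evalL2 hinv (0 + 1) f,
      Lp.coeFn_sub (evalL2 hinv 0 f) (evalL2 hinv (0 + 1) f)] with ω h1 h2 h3
    rw [h3, Pi.sub_apply, h1, h2]
  have h2 : ∀ i, ‖evalL2 hinv i f‖ ^ 2 = ‖f‖ ^ 2 := fun i => by
    rw [← real_inner_self_eq_norm_sq, ← real_inner_self_eq_norm_sq, inner_evalL2_evalL2]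
  rw [h1, lintegral_enorm_sq_coeFn, norm_sub_sq_real, h2, h2, inner_evalL2_succ hinv le_rfl,
    inner_evalL2_evalL2, inner_sub_left, real_inner_self_eq_norm_sq, real_inner_comm f]
  congr 1
  ring

variable (π) in
/-- The subspace of `L²(π)` of functions with mean zero. -/
noncomputable def centeredL2 : Submodule ℝ (Lp ℝ 2 π) :=
  (ℝ ∙ (indicatorConstLp 2 MeasurableSet.univ (measure_ne_top π Set.univ) (1 : ℝ)))ᗮ

theorem mem_centeredL2 {f : Lp ℝ 2 π} : f ∈ centeredL2 π ↔ ∫ x, f x ∂π = 0 := by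
  rw [centeredL2, Submodule.mem_orthogonal_singleton_iff_inner_right,
    L2.inner_indicatorConstLp_one, setIntegral_univ]

instance : CompleteSpace (centeredL2 π) := by unfold centeredL2; infer_instance

/-- The Markov operator on functions with mean zero. -/
noncomputable def centeredOperator (hinv : P.Invariant π) : centeredL2 π →L[ℝ] centeredL2 π :=
  ((markovOperator hinv).comp (centeredL2 π).subtypeL).codRestrict (centeredL2 π) fun f => by
    rw [mem_centeredL2]
    exact (integral_markovOperator hinv _).trans (mem_centeredL2.1 f.2)

theorem poincareInequality_iff_gap (hinv : P.Invariant π) :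
    PoincareInequality (π ⊗ₘ P) π ↔ ∃ c : ℝ, 0 < c ∧ ∀ f : centeredL2 π,
      c * ‖f‖ ^ 2 ≤ inner ℝ (f - centeredOperator hinv f) f := by
  constructor
  · rintro ⟨c, hc, h⟩
    refine ⟨c / 2, by positivity, fun f => ?_⟩
    have h1 := h (f : Lp ℝ 2 π) (Lp.stronglyMeasurable _).measurable (Lp.memLp _)
      (mem_centeredL2.1 f.2)
    rw [lintegral_enorm_sq_sub_compProd hinv, lintegral_enorm_sq_coeFn,
      ← ENNReal.ofReal_coe_nnreal, ← ENNReal.ofReal_mul c.coe_nonneg] at h1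
    change (c : ℝ) / 2 * ‖(f : Lp ℝ 2 π)‖ ^ 2 ≤ inner ℝ ((f : Lp ℝ 2 π) - markovOperator hinv f) f
    -- An inequality between values of `ENNReal.ofReal` gives a real inequality only when the left
    -- argument is positive.
    by_cases hf : ‖(f : Lp ℝ 2 π)‖ = 0
    · rw [norm_eq_zero] at hf
      simp [hf]
    · have h2 := (ENNReal.ofReal_le_ofReal_iff' (p := c * ‖(f : Lp ℝ 2 π)‖ ^ 2)).1 h1
      have h3 : 0 < c * ‖(f : Lp ℝ 2 π)‖ ^ 2 := by positivity
      rcases h2 with h2 | h2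
      · linarith
      · exact absurd h2 (not_le.2 h3)
  · rintro ⟨c, hc, h⟩
    refine ⟨(2 * c).toNNReal, by simpa using hc, fun f _ hf hf0 => ?_⟩
    have hae := hf.coeFn_toLp
    have hmem : hf.toLp f ∈ centeredL2 π := by
      rw [mem_centeredL2, integral_congr_ae hae, hf0]
    have h1 := h ⟨_, hmem⟩
    change c * ‖hf.toLp f‖ ^ 2 ≤
      inner ℝ (hf.toLp f - markovOperator hinv (hf.toLp f)) (hf.toLp f) at h1
    have h2 : ∫⁻ x, ‖f x‖ₑ ^ 2 ∂π = ∫⁻ x, ‖hf.toLp f x‖ₑ ^ 2 ∂π := by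
      refine lintegral_congr_ae ?_
      filter_upwards [hae] with x hx
      rw [hx]
    have h3 : ∫⁻ z, ‖f z.1 - f z.2‖ₑ ^ 2 ∂(π ⊗ₘ P) =
        ∫⁻ z, ‖hf.toLp f z.1 - hf.toLp f z.2‖ₑ ^ 2 ∂(π ⊗ₘ P) := by
      refine lintegral_congr_ae ?_
      filter_upwards [(measurePreserving_fst_compProd (P := P)).quasiMeasurePreserving.ae hae,
        (measurePreserving_snd_compProd hinv).quasiMeasurePreserving.ae hae] with z hz1 hz2
      rw [hz1, hz2]
    rw [h2, h3, lintegral_enorm_sq_sub_compProd hinv, lintegral_enorm_sq_coeFn,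
      ENNReal.ofNNReal_toNNReal, ← ENNReal.ofReal_mul (by positivity)]
    exact ENNReal.ofReal_le_ofReal (by linarith)

/-- The `n`-th normalized variance of `h` is that of the partial sums of its centering in `L²`. -/
theorem variance_average_eq (hinv : P.Invariant π) {h : S → ℝ} (hh : MemLp h 2 π)
    (f : Lp ℝ 2 π) (hf : f =ᵐ[π] fun x => h x - ∫ y, h y ∂π) (n : ℕ) :
    (n : ℝ) * variance (fun ω : ℕ → S => (1 / (n : ℝ)) * ∑ i ∈ Finset.range n, h (ω i))
        (chainLaw P π) =
      ‖∑ i ∈ Finset.range n, evalL2 hinv i f‖ ^ 2 / n := by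
  -- At n = 0 both sides are 0, division by zero included.
  rcases Nat.eq_zero_or_pos n with rfl | hn
  · simp
  have hn' : (n : ℝ) ≠ 0 := by positivity
  set m := ∫ y, h y ∂π with hm
  have hsum : ∀ᵐ ω ∂chainLaw P π, (∑ i ∈ Finset.range n, evalL2 hinv i f : Lp ℝ 2 (chainLaw P π)) ω
      = ∑ i ∈ Finset.range n, h (ω i) - n * m := by
    clear hn hn'
    induction n with
    | zero =>
      filter_upwards [Lp.coeFn_zero ℝ 2 (chainLaw P π)] with ω hω
      simpa using hω
    | succ n ih =>
      rw [Finset.sum_range_succ]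
      filter_upwards [ih, Lp.coeFn_add (∑ i ∈ Finset.range n, evalL2 hinv i f) (evalL2 hinv n f),
        coeFn_evalL2 hinv n f,
        (measurePreserving_eval_chainLaw hinv n).quasiMeasurePreserving.ae hf] with ω h1 h2 h3 h4
      rw [h2, Pi.add_apply, h1, h3, h4, Finset.sum_range_succ]
      push_cast
      ring
  set F := (∑ i ∈ Finset.range n, evalL2 hinv i f : Lp ℝ 2 (chainLaw P π)) with hF
  have h0 : ∀ i, ∫ ω, h (ω i) ∂chainLaw P π = m := fun i => by
    have hp := measurePreserving_eval_chainLaw hinv i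
    rw [← integral_map (φ := fun ω : ℕ → S => ω i) hp.measurable.aemeasurable
      (by rw [hp.map_eq]; exact hh.1), hp.map_eq]
  have hi : ∀ i, Integrable (fun ω : ℕ → S => h (ω i)) (chainLaw P π) := fun i =>
    (hh.comp_measurePreserving (measurePreserving_eval_chainLaw hinv i)).integrable (by norm_num)
  have hint0 : ∫ ω, F ω ∂chainLaw P π = 0 := by
    rw [integral_congr_ae hsum, integral_sub (integrable_finsetSum _ fun i _ => hi i)
      (integrable_const _), integral_finsetSum _ fun i _ => hi i]
    simp [h0]
  have hvar : Var[fun ω : ℕ → S => ∑ i ∈ Finset.range n, h (ω i); chainLaw P π] = ‖F‖ ^ 2 := by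
    have h1 : Var[fun ω : ℕ → S => ∑ i ∈ Finset.range n, h (ω i); chainLaw P π] =
        Var[fun ω : ℕ → S => ∑ i ∈ Finset.range n, h (ω i) - n * m; chainLaw P π] :=
      (variance_sub_const (integrable_finsetSum _ fun i _ => hi i).1 _).symm
    rw [h1, ← variance_congr hsum, variance_of_integral_eq_zero (Lp.memLp F).1.aemeasurable hint0,
      ← real_inner_self_eq_norm_sq, L2.inner_def]
    refine integral_congr_ae (Eventually.of_forall fun ω => ?_)
    simp [pow_two]
  rw [variance_const_mul, hvar]
  field_simp

/-- The abstract chain lemmas are applied on mean-zero functions, since constants are fixed by the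
operator and rule out coercivity on all of L²(π). The forward direction uses only that convergent
sequences are bounded. -/
theorem varianceBounding_iff_poincareInequality
    (hrev : (π ⊗ₘ P).map Prod.swap = π ⊗ₘ P) :
    VarianceBounding P π ↔ PoincareInequality (π ⊗ₘ P) π := by
  have hinv : P.Invariant π := by
    -- Reversibility implies invariance by comparing second marginals.
    have h := congrArg Measure.snd hrev
    rw [Measure.snd_map_swap, Measure.fst_compProd, Measure.snd_compProd] at h
    exact h.symm
  rw [poincareInequality_iff_gap hinv]
  let U : ℕ → centeredL2 π →L[ℝ] Lp ℝ 2 (chainLaw P π) := fun i =>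
    (evalL2 hinv i).comp (centeredL2 π).subtypeL
  have hU : ∀ i f g, inner ℝ (U i f) (U i g) = inner ℝ f g := fun i f g =>
    inner_evalL2_evalL2 hinv i _ _
  have hmarkov : ∀ i n f g, i ≤ n →
      inner ℝ (U i f) (U (n + 1) g) = inner ℝ (U i f) (U n (centeredOperator hinv g)) :=
    fun i n f g hi => inner_evalL2_succ hinv hi _ _
  have hsumU : ∀ n (f : centeredL2 π), ∑ i ∈ Finset.range n, U i f =
      ∑ i ∈ Finset.range n, evalL2 hinv i (f : Lp ℝ 2 π) := fun _ _ => rfl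
  constructor
  · intro h
    refine exists_gap_of_norm_sq_sum_chain_le hU hmarkov fun f => ?_
    obtain ⟨s, hs⟩ := h (f : Lp ℝ 2 π) (Lp.memLp _)
    obtain ⟨C, hC⟩ := hs.bddAbove_range
    refine ⟨C, fun n => ?_⟩
    rw [hsumU, ← variance_average_eq hinv (Lp.memLp _) (f : Lp ℝ 2 π)
      (Eventually.of_forall fun x => by rw [mem_centeredL2.1 f.2]; exact (sub_zero _).symm)]
    exact hC ⟨n, rfl⟩
  · rintro ⟨c, hc, hgap⟩ h hh
    have hcent : MemLp (fun x => h x - ∫ y, h y ∂π) 2 π := hh.sub (memLp_const _)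
    have hmem : hcent.toLp _ ∈ centeredL2 π := by
      rw [mem_centeredL2, integral_congr_ae hcent.coeFn_toLp,
        integral_sub (hh.integrable (by norm_num)) (integrable_const _)]
      simp
    obtain ⟨s, hs⟩ := tendsto_norm_sq_sum_chain_div
      (P := centeredOperator hinv) (fun f g => markovOperator_symm hinv hrev _ _) hU hmarkov
      (fun f => norm_markovOperator_apply_le hinv _) hc hgap ⟨_, hmem⟩
    refine ⟨s, hs.congr fun n => ?_⟩
    rw [hsumU]
    exact (variance_average_eq hinv hh _ hcent.coeFn_toLp n).symm

end SpectralGap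

/-! ### Dirichlet forms of Metropolis–Hastings kernels and their comparison -/

section MetropolisHastingsFlow

variable {S : Type*} [MeasurableSpace S] {μ : Measure S}

/-- The density of the accepted stationary moves of a Metropolis-Hastings chain. -/
noncomputable def mhFlow (π : TargetDensity S μ) (Q : ProposalDensity S μ) (x y : S) : ℝ≥0 :=
  min (π.dens x * Q.dens x y) (π.dens y * Q.dens y x)

theorem mhFlow_comm (π : TargetDensity S μ) (Q : ProposalDensity S μ) (x y : S) :
    mhFlow π Q x y = mhFlow π Q y x :=
  min_comm _ _

theorem measurable_uncurry_mhFlow (π : TargetDensity S μ) (Q : ProposalDensity S μ) :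
    Measurable (Function.uncurry (mhFlow π Q)) :=
  ((π.measurable_dens.comp measurable_fst).mul Q.measurable_dens).min
    ((π.measurable_dens.comp measurable_snd).mul (Q.measurable_dens.comp measurable_swap))

/-- If the denominator of the acceptance ratio vanishes, both sides are 0, so the convention for
that case has no effect on the stationary flow. -/
theorem dens_mul_mhAccept (π : TargetDensity S μ) (Q : ProposalDensity S μ) (x y : S) :
    π.dens x * (Q.dens x y * mhAccept π Q x y) = mhFlow π Q x y := by
  unfold mhAccept mhFlow
  split_ifs with h
  · rw [mul_one, h, min_eq_left zero_le]
  · rw [← mul_assoc, mul_min, mul_one, mul_div_cancel₀ _ h]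

instance (π : TargetDensity S μ) : IsProbabilityMeasure π.toMeasure :=
  ⟨by rw [TargetDensity.toMeasure, withDensity_apply _ MeasurableSet.univ, setLIntegral_univ,
    π.lintegral_dens]⟩

theorem TargetDensity.lintegral_toMeasure (π : TargetDensity S μ) {f : S → ℝ≥0∞}
    (hf : Measurable f) : ∫⁻ x, f x ∂π.toMeasure = ∫⁻ x, π.dens x * f x ∂μ :=
  lintegral_withDensity_eq_lintegral_mul μ π.measurable_dens.coe_nnreal_ennreal hf

variable [SFinite μ]

theorem lintegral_mhKernel (π : TargetDensity S μ) (Q : ProposalDensity S μ) (x : S)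
    {f : S → ℝ≥0∞} (hf : Measurable f) :
    ∫⁻ y, f y ∂mhKernel π Q x =
      ∫⁻ y, (Q.dens x y * mhAccept π Q x y : ℝ≥0) * f y ∂μ + (1 - mhMeanAccept π Q x) * f x := by
  have h2 : Measurable (Function.uncurry fun (x _ : S) => 1 - mhMeanAccept π Q x) :=
    (measurable_const.sub (measurable_mhMeanAccept π Q)).comp measurable_fst
  rw [mhKernel, _root_.add_apply, lintegral_add_measure,
    Kernel.lintegral_withDensity _ (measurable_mhFlow π Q) _ hf,
    Kernel.lintegral_withDensity _ h2 _ hf, Kernel.const_apply, Kernel.deterministic_apply,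
    lintegral_dirac' _ (by fun_prop)]
  simp

theorem lintegral_compProd_mhKernel (π : TargetDensity S μ) (Q : ProposalDensity S μ)
    {F : S × S → ℝ≥0∞} (hF : Measurable F) :
    ∫⁻ z, F z ∂(π.toMeasure ⊗ₘ mhKernel π Q) =
      ∫⁻ x, ∫⁻ y, mhFlow π Q x y * F (x, y) ∂μ ∂μ
        + ∫⁻ x, π.dens x * ((1 - mhMeanAccept π Q x) * F (x, x)) ∂μ := by
  have hw : Measurable fun z : S × S => (mhFlow π Q z.1 z.2 : ℝ≥0∞) * F z :=
    (measurable_uncurry_mhFlow π Q).coe_nnreal_ennreal.mul hF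
  rw [Measure.lintegral_compProd hF, π.lintegral_toMeasure hF.lintegral_kernel_prod_right',
    ← lintegral_add_left hw.lintegral_prod_right']
  refine lintegral_congr fun x => ?_
  have hx : Measurable fun y => F (x, y) := by fun_prop
  have hq : Measurable fun y => ((Q.dens x y * mhAccept π Q x y : ℝ≥0) : ℝ≥0∞) :=
    ((Q.measurable_dens.comp measurable_prodMk_left).mul
      ((measurable_mhAccept π Q).comp measurable_prodMk_left)).coe_nnreal_ennreal
  have hqx : Measurable fun y => ((Q.dens x y * mhAccept π Q x y : ℝ≥0) : ℝ≥0∞) * F (x, y) :=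
    hq.mul hx
  rw [lintegral_mhKernel π Q x hx, mul_add, ← lintegral_const_mul _ hqx]
  congr 1
  refine lintegral_congr fun y => ?_
  rw [← dens_mul_mhAccept, ENNReal.coe_mul (π.dens x), mul_assoc]

/-- Detailed balance: the flow of accepted moves is symmetric, and the rejected moves sit on the
diagonal, which the swap fixes. -/
theorem map_swap_compProd_mhKernel (π : TargetDensity S μ) (Q : ProposalDensity S μ) :
    (π.toMeasure ⊗ₘ mhKernel π Q).map Prod.swap = π.toMeasure ⊗ₘ mhKernel π Q := by
  ext s hs
  have h1 : Measurable (s.indicator (1 : S × S → ℝ≥0∞)) := measurable_one.indicator hs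
  have h2 : Measurable fun z : S × S => s.indicator (1 : S × S → ℝ≥0∞) z.swap :=
    h1.comp measurable_swap
  have hw : Measurable fun z : S × S =>
      (mhFlow π Q z.1 z.2 : ℝ≥0∞) * s.indicator (1 : S × S → ℝ≥0∞) z.swap :=
    (measurable_uncurry_mhFlow π Q).coe_nnreal_ennreal.mul h2
  rw [← lintegral_indicator_one hs, ← lintegral_indicator_one hs, lintegral_map h1 measurable_swap,
    lintegral_compProd_mhKernel π Q h2, lintegral_compProd_mhKernel π Q h1,
    lintegral_lintegral_swap hw.aemeasurable]
  simp only [Prod.swap_prod_mk]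
  congr 1
  refine lintegral_congr fun x => lintegral_congr fun y => ?_
  rw [mhFlow_comm]

/-- Rejections drop out because the integrand vanishes on the diagonal; the form is therefore
monotone in the flow. -/
theorem lintegral_enorm_sq_sub_mhKernel (π : TargetDensity S μ) (Q : ProposalDensity S μ)
    {f : S → ℝ} (hf : Measurable f) :
    ∫⁻ z, ‖f z.1 - f z.2‖ₑ ^ 2 ∂(π.toMeasure ⊗ₘ mhKernel π Q) =
      ∫⁻ x, ∫⁻ y, mhFlow π Q x y * ‖f x - f y‖ₑ ^ 2 ∂μ ∂μ := by
  rw [lintegral_compProd_mhKernel π Q (by fun_prop)]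
  simp

/-- The part of the Dirichlet form coming from a symmetric set of moves that are rarely made. -/
theorem lintegral_mhFlow_indicator_le (π : TargetDensity S μ) (Q : ProposalDensity S μ)
    {N : Set (S × S)} (hN : MeasurableSet N) (hsymm : ∀ x y, (x, y) ∈ N → (y, x) ∈ N)
    {ε : ℝ≥0} (hε : ∀ᵐ x ∂μ, ∫⁻ y, N.indicator 1 (x, y) * (mhFlow π Q x y : ℝ≥0∞) ∂μ ≤ ε * π.dens x)
    {f : S → ℝ} (hf : Measurable f) :
    ∫⁻ x, ∫⁻ y, N.indicator 1 (x, y) * (mhFlow π Q x y : ℝ≥0∞) * ‖f x - f y‖ₑ ^ 2 ∂μ ∂μ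
      ≤ 4 * ε * ∫⁻ x, ‖f x‖ₑ ^ 2 ∂π.toMeasure := by
  set w : S → S → ℝ≥0∞ := fun x y => N.indicator 1 (x, y) * (mhFlow π Q x y : ℝ≥0∞) with hw
  have hwm : Measurable fun z : S × S => w z.1 z.2 :=
    (measurable_one.indicator hN).mul (measurable_uncurry_mhFlow π Q).coe_nnreal_ennreal
  have hws : ∀ x, Measurable fun y => w x y := fun x => hwm.comp measurable_prodMk_left
  have hwc : ∀ x y, w x y = w y x := fun x y => by
    have : N.indicator (1 : S × S → ℝ≥0∞) (x, y) = N.indicator 1 (y, x) := by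
      by_cases h : (x, y) ∈ N
      · rw [Set.indicator_of_mem h, Set.indicator_of_mem (hsymm _ _ h)]; rfl
      · rw [Set.indicator_of_notMem h, Set.indicator_of_notMem fun h' => h (hsymm _ _ h')]
    simp only [hw, this, mhFlow_comm π Q x y]
  have hw1 : Measurable fun z : S × S => w z.1 z.2 * ‖f z.1‖ₑ ^ 2 := by fun_prop
  have hw2 : Measurable fun z : S × S => w z.1 z.2 * ‖f z.2‖ₑ ^ 2 := by fun_prop
  have hsq : ∀ a b : ℝ, ‖a - b‖ₑ ^ 2 ≤ 2 * (‖a‖ₑ ^ 2 + ‖b‖ₑ ^ 2) := fun a b => by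
    have h : (a - b) ^ 2 ≤ 2 * (a ^ 2 + b ^ 2) := by nlinarith [sq_nonneg (a + b)]
    have h' := ENNReal.ofReal_le_ofReal h
    rwa [ENNReal.ofReal_mul zero_le_two, ENNReal.ofReal_add (sq_nonneg a) (sq_nonneg b),
      ← sq_abs (a - b), ← sq_abs a, ← sq_abs b, ENNReal.ofReal_pow (abs_nonneg _),
      ENNReal.ofReal_pow (abs_nonneg _), ENNReal.ofReal_pow (abs_nonneg _),
      ← Real.norm_eq_abs, ← Real.norm_eq_abs, ← Real.norm_eq_abs, ofReal_norm,
      ofReal_norm, ofReal_norm, ENNReal.ofReal_ofNat] at h'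
  -- This bounds one of the two terms from (a - b)² ≤ 2(a² + b²); the other equals it by symmetry of
  -- `w`, whence the factor 4.
  have hhalf : ∫⁻ x, ∫⁻ y, w x y * ‖f x‖ₑ ^ 2 ∂μ ∂μ ≤ ε * ∫⁻ x, ‖f x‖ₑ ^ 2 ∂π.toMeasure := by
    rw [π.lintegral_toMeasure (by fun_prop), ← lintegral_const_mul _
      (by have := π.measurable_dens; fun_prop)]
    refine lintegral_mono_ae ?_
    filter_upwards [hε] with x hx
    rw [lintegral_mul_const _ (hws x), ← mul_assoc]
    gcongr
  calc ∫⁻ x, ∫⁻ y, w x y * ‖f x - f y‖ₑ ^ 2 ∂μ ∂μ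
      ≤ ∫⁻ x, ∫⁻ y, 2 * (w x y * ‖f x‖ₑ ^ 2 + w x y * ‖f y‖ₑ ^ 2) ∂μ ∂μ := by
        refine lintegral_mono fun x => lintegral_mono fun y => ?_
        calc w x y * ‖f x - f y‖ₑ ^ 2 ≤ w x y * (2 * (‖f x‖ₑ ^ 2 + ‖f y‖ₑ ^ 2)) := by
              gcongr; exact hsq _ _
          _ = _ := by ring
    _ = 2 * (∫⁻ x, ∫⁻ y, w x y * ‖f x‖ₑ ^ 2 ∂μ ∂μ + ∫⁻ x, ∫⁻ y, w x y * ‖f y‖ₑ ^ 2 ∂μ ∂μ) := by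
        rw [← lintegral_add_left hw1.lintegral_prod_right', ← lintegral_const_mul' _ _ (by simp)]
        refine lintegral_congr fun x => ?_
        rw [lintegral_const_mul' _ _ (by simp), lintegral_add_left ((hws x).mul_const _)]
    _ = 2 * (∫⁻ x, ∫⁻ y, w x y * ‖f x‖ₑ ^ 2 ∂μ ∂μ + ∫⁻ x, ∫⁻ y, w x y * ‖f x‖ₑ ^ 2 ∂μ ∂μ) := by
        congr 2
        rw [lintegral_lintegral_swap hw2.aemeasurable]
        refine lintegral_congr fun x => lintegral_congr fun y => ?_
        rw [hwc]
    _ ≤ 2 * (ε * ∫⁻ x, ‖f x‖ₑ ^ 2 ∂π.toMeasure + ε * ∫⁻ x, ‖f x‖ₑ ^ 2 ∂π.toMeasure) := by gcongr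
    _ = 4 * ε * ∫⁻ x, ‖f x‖ₑ ^ 2 ∂π.toMeasure := by ring

/-- Comparison of Poincaré inequalities: it is enough to compare the flows outside a set of moves
that carries little of the first flow. -/
theorem PoincareInequality.of_mhFlow_le (π : TargetDensity S μ) (Q₁ Q₂ : ProposalDensity S μ)
    (hcomp : ∀ ε : ℝ≥0, 0 < ε → ∃ (C : ℝ≥0) (N : Set (S × S)), MeasurableSet N ∧
      (∀ x y, (x, y) ∈ N → (y, x) ∈ N) ∧
      (∀ᵐ x ∂μ, ∫⁻ y, N.indicator 1 (x, y) * (mhFlow π Q₁ x y : ℝ≥0∞) ∂μ ≤ ε * π.dens x) ∧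
      ∀ᵐ x ∂μ, ∀ᵐ y ∂μ, (x, y) ∉ N → mhFlow π Q₁ x y ≤ C * mhFlow π Q₂ x y)
    (h : PoincareInequality (π.toMeasure ⊗ₘ mhKernel π Q₁) π.toMeasure) :
    PoincareInequality (π.toMeasure ⊗ₘ mhKernel π Q₂) π.toMeasure := by
  obtain ⟨c, hc, h⟩ := h
  -- With ε = c/8 the long moves cost 4ε = c/2 times the squared norm, half of what the Poincaré
  -- inequality provides.
  obtain ⟨C, N, hN, hsymm, htail, hle⟩ := hcomp (c / 8) (by positivity)
  -- `C + 1` instead of `C`, which may be 0.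
  refine ⟨c / 2 / (C + 1), by positivity, fun f hf hf2 hf0 => ?_⟩
  have h1 := h f hf hf2 hf0
  rw [lintegral_enorm_sq_sub_mhKernel π _ hf] at h1 ⊢
  set A := ∫⁻ x, ‖f x‖ₑ ^ 2 ∂π.toMeasure with hA
  set D := ∫⁻ x, ∫⁻ y, (mhFlow π Q₂ x y : ℝ≥0∞) * ‖f x - f y‖ₑ ^ 2 ∂μ ∂μ with hD
  -- Finiteness is what permits subtracting the absorbed term in `ℝ≥0∞`.
  have hAtop : A ≠ ⊤ := by
    rw [hA, ← eLpNorm_two_sq_eq_lintegral]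
    exact ENNReal.pow_ne_top hf2.2.ne
  have hfar : Measurable fun z : S × S =>
      N.indicator 1 z * (mhFlow π Q₁ z.1 z.2 : ℝ≥0∞) * ‖f z.1 - f z.2‖ₑ ^ 2 :=
    ((measurable_one.indicator hN).mul
      (measurable_uncurry_mhFlow π Q₁).coe_nnreal_ennreal).mul (by fun_prop)
  have hw2 : Measurable fun z : S × S =>
      (mhFlow π Q₂ z.1 z.2 : ℝ≥0∞) * ‖f z.1 - f z.2‖ₑ ^ 2 :=
    (measurable_uncurry_mhFlow π Q₂).coe_nnreal_ennreal.mul (by fun_prop)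
  have h2 : ∫⁻ x, ∫⁻ y, (mhFlow π Q₁ x y : ℝ≥0∞) * ‖f x - f y‖ₑ ^ 2 ∂μ ∂μ
      ≤ (c / 2 : ℝ≥0) * A + C * D := by
    calc ∫⁻ x, ∫⁻ y, (mhFlow π Q₁ x y : ℝ≥0∞) * ‖f x - f y‖ₑ ^ 2 ∂μ ∂μ
        ≤ ∫⁻ x, (∫⁻ y, N.indicator 1 (x, y) * (mhFlow π Q₁ x y : ℝ≥0∞) * ‖f x - f y‖ₑ ^ 2 ∂μ
          + C * ∫⁻ y, (mhFlow π Q₂ x y : ℝ≥0∞) * ‖f x - f y‖ₑ ^ 2 ∂μ) ∂μ := by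
          refine lintegral_mono_ae ?_
          filter_upwards [hle] with x hx
          rw [← lintegral_const_mul' _ _ ENNReal.coe_ne_top,
            ← lintegral_add_left (f := fun y => N.indicator 1 (x, y) * (mhFlow π Q₁ x y : ℝ≥0∞)
              * ‖f x - f y‖ₑ ^ 2) (hfar.comp measurable_prodMk_left)]
          refine lintegral_mono_ae ?_
          filter_upwards [hx] with y hy
          by_cases hxy : (x, y) ∈ N
          · simp [Set.indicator_of_mem hxy]
          · rw [Set.indicator_of_notMem hxy, zero_mul, zero_mul, zero_add, ← mul_assoc,
              ← ENNReal.coe_mul]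
            gcongr
            exact hy hxy
      _ = ∫⁻ x, ∫⁻ y, N.indicator 1 (x, y) * (mhFlow π Q₁ x y : ℝ≥0∞) * ‖f x - f y‖ₑ ^ 2 ∂μ ∂μ
          + C * D := by
          rw [lintegral_add_left hfar.lintegral_prod_right', lintegral_const_mul _
            hw2.lintegral_prod_right']
      _ ≤ 4 * (c / 8 : ℝ≥0) * A + C * D := by
          gcongr
          exact lintegral_mhFlow_indicator_le π Q₁ hN hsymm htail hf
      _ = (c / 2 : ℝ≥0) * A + C * D := by
          congr 2
          rw [show (4 : ℝ≥0∞) = ((4 : ℝ≥0) : ℝ≥0∞) by norm_num, ← ENNReal.coe_mul]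
          congr 1
          ext
          push_cast
          ring
  have h3 : ((c / 2 : ℝ≥0) : ℝ≥0∞) * A ≤ C * D := by
    have h4 : (c : ℝ≥0∞) * A = (c / 2 : ℝ≥0) * A + (c / 2 : ℝ≥0) * A := by
      rw [← add_mul, ← ENNReal.coe_add, add_halves]
    rw [h4] at h1
    exact ENNReal.le_of_add_le_add_left (ENNReal.mul_ne_top ENNReal.coe_ne_top hAtop) (h1.trans h2)
  calc ((c / 2 / (C + 1) : ℝ≥0) : ℝ≥0∞) * A
      = ((C + 1)⁻¹ : ℝ≥0) * ((c / 2 : ℝ≥0) * A) := by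
        rw [← mul_assoc, ← ENNReal.coe_mul, div_eq_inv_mul (c / 2)]
    _ ≤ ((C + 1)⁻¹ : ℝ≥0) * ((C + 1 : ℝ≥0) * D) := by
        refine mul_le_mul_right (h3.trans ?_) _
        gcongr
        exact le_self_add
    _ = D := by
        rw [← mul_assoc, ← ENNReal.coe_mul, inv_mul_cancel₀ (by positivity), ENNReal.coe_one,
          one_mul]

end MetropolisHastingsFlow

/-! ### Comparison of Gaussian proposals with bounded drift -/

section GaussianComparison

variable {d : ℕ}

theorem gaussianDensity_eq_sub (m : EuclideanSpace ℝ (Fin d)) (σ : ℝ)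
    (y : EuclideanSpace ℝ (Fin d)) : gaussianDensity m σ y = gaussianDensity 0 σ (y - m) := by
  simp [gaussianDensity]

theorem measurable_gaussianDensity (m : EuclideanSpace ℝ (Fin d)) (σ : ℝ) :
    Measurable (gaussianDensity m σ) := by
  unfold gaussianDensity
  fun_prop

theorem gaussianDensity_le (m : EuclideanSpace ℝ (Fin d)) {σ : ℝ} (hσ : 0 < σ)
    (y : EuclideanSpace ℝ (Fin d)) :
    gaussianDensity m σ y ≤ (2 * Real.pi * σ ^ 2) ^ (-(d : ℝ) / 2) := by
  unfold gaussianDensity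
  refine mul_le_of_le_one_right (by positivity) (Real.exp_le_one_iff.2 ?_)
  rw [neg_mul, neg_nonpos]
  positivity

theorem le_gaussianDensity {m : EuclideanSpace ℝ (Fin d)} {σ : ℝ} (hσ : 0 < σ)
    {y : EuclideanSpace ℝ (Fin d)} {R : ℝ} (hR : ‖y - m‖ ≤ R) :
    (2 * Real.pi * σ ^ 2) ^ (-(d : ℝ) / 2) * Real.exp (-(1 / (2 * σ ^ 2)) * R ^ 2)
      ≤ gaussianDensity m σ y := by
  unfold gaussianDensity
  rw [neg_mul, neg_mul]
  gcongr

/-- On a bounded range of moves two Gaussian densities are comparable. -/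
theorem exists_gaussianDensity_le_mul {σ₁ σ₂ : ℝ} (h₁ : 0 < σ₁) (h₂ : 0 < σ₂) (R : ℝ) :
    ∃ C : ℝ≥0, ∀ m₁ m₂ y : EuclideanSpace ℝ (Fin d), ‖y - m₂‖ ≤ R →
      (gaussianDensity m₁ σ₁ y).toNNReal ≤ C * (gaussianDensity m₂ σ₂ y).toNNReal := by
  -- `a` is the maximum of the first density and `b` a lower bound for the second on the ball of
  -- radius `R`; their ratio serves whatever the first mean is.
  set a := (2 * Real.pi * σ₁ ^ 2) ^ (-(d : ℝ) / 2) with ha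
  set b := (2 * Real.pi * σ₂ ^ 2) ^ (-(d : ℝ) / 2) * Real.exp (-(1 / (2 * σ₂ ^ 2)) * R ^ 2) with hb
  have ha0 : 0 < a := by positivity
  have hb0 : 0 < b := by positivity
  refine ⟨(a / b).toNNReal, fun m₁ m₂ y hy => ?_⟩
  rw [← Real.toNNReal_mul (by positivity)]
  refine Real.toNNReal_le_toNNReal ((gaussianDensity_le m₁ h₁ y).trans ?_)
  calc a = a / b * b := by field_simp
    _ ≤ a / b * gaussianDensity m₂ σ₂ y := by
      gcongr
      exact le_gaussianDensity h₂ hy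

/-- The Gaussian density has small mass outside large balls. -/
theorem exists_lintegral_gaussianDensity_le {σ : ℝ} (hσ : 0 < σ) {ε : ℝ≥0} (hε : 0 < ε) :
    ∃ r : ℝ, ∫⁻ z : EuclideanSpace ℝ (Fin d),
      {z | r < ‖z‖}.indicator (fun z => ENNReal.ofReal (gaussianDensity 0 σ z)) z ≤ ε := by
  have hm : Measurable fun z : EuclideanSpace ℝ (Fin d) =>
      ENNReal.ofReal (gaussianDensity 0 σ z) := (measurable_gaussianDensity 0 σ).ennreal_ofReal
  have hlim : Tendsto (fun n : ℕ => ∫⁻ z : EuclideanSpace ℝ (Fin d),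
      {z | (n : ℝ) < ‖z‖}.indicator (fun z => ENNReal.ofReal (gaussianDensity 0 σ z)) z) atTop
      (𝓝 (∫⁻ _ : EuclideanSpace ℝ (Fin d), 0)) := by
    refine tendsto_lintegral_of_dominated_convergence
      (fun z => ENNReal.ofReal (gaussianDensity 0 σ z))
      (fun n => hm.indicator (measurableSet_lt measurable_const measurable_norm))
      (fun n => Eventually.of_forall fun z => Set.indicator_le_self _ _ _)
      (by rw [lintegral_gaussianDensity 0 hσ]; exact ENNReal.one_ne_top)
      (Eventually.of_forall fun z => ?_)
    refine tendsto_const_nhds.congr' ?_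
    obtain ⟨n₀, hn₀⟩ := exists_nat_ge ‖z‖
    filter_upwards [eventually_ge_atTop n₀] with n hn
    rw [Set.indicator_of_notMem]
    simp only [Set.mem_ofPred_eq, not_lt]
    exact hn₀.trans (by exact_mod_cast hn)
  rw [lintegral_zero] at hlim
  obtain ⟨n, hn⟩ := (hlim.eventually_le_const (ENNReal.coe_pos.2 hε)).exists
  exact ⟨n, hn⟩

variable {X : Set (EuclideanSpace ℝ (Fin d))}

theorem lintegral_pos_le {f : EuclideanSpace ℝ (Fin d) → ℝ≥0∞} (hf : Measurable f) :
    ∫⁻ y, f y.pos ∂lebesgueOn X ≤ ∫⁻ y, f y := by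
  have hmap : (lebesgueOn X).map LebesgueSpace.pos ≤ volume :=
    Measure.le_iff.2 fun s hs => by
      rw [Measure.map_apply LebesgueSpace.measurable_pos hs]
      exact lebesgueOn_preimage_le X hs
  rw [← lintegral_map hf LebesgueSpace.measurable_pos]
  exact lintegral_mono' hmap le_rfl

/-- Large moves of a Gaussian proposal with a bounded drift are unlikely. -/
theorem lintegral_gaussianProposal_far_le {v : LebesgueSpace X → EuclideanSpace ℝ (Fin d)}
    (hv : Measurable v) {σ : ℝ} (hσ : 0 < σ) {r M : ℝ} {x : LebesgueSpace X} (hx : ‖v x‖ ≤ M) :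
    ∫⁻ y, {z : LebesgueSpace X × LebesgueSpace X | r + M < ‖z.1.pos - z.2.pos‖}.indicator 1 (x, y)
        * ((gaussianProposal X v hv σ hσ).dens x y : ℝ≥0∞) ∂lebesgueOn X ≤
      ∫⁻ z : EuclideanSpace ℝ (Fin d),
        {z | r < ‖z‖}.indicator (fun z => ENNReal.ofReal (gaussianDensity 0 σ z)) z := by
  set k : EuclideanSpace ℝ (Fin d) → ℝ≥0∞ :=
    {z | r < ‖z‖}.indicator (fun z => ENNReal.ofReal (gaussianDensity 0 σ z)) with hk
  have hkm : Measurable k := (measurable_gaussianDensity 0 σ).ennreal_ofReal.indicator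
    (measurableSet_lt measurable_const measurable_norm)
  set m := x.pos + v x with hm
  calc _ ≤ ∫⁻ y : LebesgueSpace X, k (y.pos - m) ∂lebesgueOn X := by
        refine lintegral_mono fun y => ?_
        by_cases hxy : r + M < ‖x.pos - y.pos‖
        -- The drift accounts for at most `M` of the move, so the Gaussian noise exceeds `r`.
        · have hr : r < ‖y.pos - m‖ := by
            have h1 : x.pos - y.pos = -(y.pos - m) - v x := by rw [hm]; abel
            have h2 : ‖x.pos - y.pos‖ ≤ ‖y.pos - m‖ + ‖v x‖ := by
              rw [h1]
              exact (norm_sub_le _ _).trans (by rw [norm_neg])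
            linarith
          rw [Set.indicator_of_mem (by exact hxy), hk, Set.indicator_of_mem (by exact hr),
            ← gaussianDensity_eq_sub, Pi.one_apply, one_mul]
          exact le_rfl
        · rw [Set.indicator_of_notMem (by exact hxy), zero_mul]
          exact zero_le
    _ ≤ ∫⁻ y : EuclideanSpace ℝ (Fin d), k (y - m) :=
        lintegral_pos_le (hkm.comp (measurable_id.sub_const m))
    _ = ∫⁻ z, k z := lintegral_sub_right_eq_self k m

/-- A π-null set can have positive Lebesgue measure, so the bound is restricted to points of
positive density; elsewhere the flow is zero. -/
theorem exists_ae_norm_le_of_essSup_lt_top {π : TargetDensity (LebesgueSpace X) (lebesgueOn X)}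
    {v : LebesgueSpace X → EuclideanSpace ℝ (Fin d)}
    (hv : essSup (fun x => ‖v x‖ₑ) π.toMeasure < ⊤) :
    ∃ M : ℝ, ∀ᵐ x ∂lebesgueOn X, π.dens x ≠ 0 → ‖v x‖ ≤ M := by
  refine ⟨(essSup (fun x => ‖v x‖ₑ) π.toMeasure).toReal, ?_⟩
  have h := ae_le_essSup (μ := π.toMeasure) (f := fun x => ‖v x‖ₑ)
  rw [TargetDensity.toMeasure, ae_withDensity_iff π.measurable_dens.coe_nnreal_ennreal] at h
  filter_upwards [h] with x hx h0
  rw [← toReal_enorm]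
  exact ENNReal.toReal_mono hv.ne (hx (by simpa using h0))

theorem PoincareInequality.of_gaussianProposal
    (π : TargetDensity (LebesgueSpace X) (lebesgueOn X))
    {v₁ v₂ : LebesgueSpace X → EuclideanSpace ℝ (Fin d)} (hv₁ : Measurable v₁) (hv₂ : Measurable v₂)
    (hb₁ : essSup (fun x => ‖v₁ x‖ₑ) π.toMeasure < ⊤)
    (hb₂ : essSup (fun x => ‖v₂ x‖ₑ) π.toMeasure < ⊤)
    {σ₁ σ₂ : ℝ} (hσ₁ : 0 < σ₁) (hσ₂ : 0 < σ₂)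
    (h : PoincareInequality (π.toMeasure ⊗ₘ mhKernel π (gaussianProposal X v₁ hv₁ σ₁ hσ₁))
      π.toMeasure) :
    PoincareInequality (π.toMeasure ⊗ₘ mhKernel π (gaussianProposal X v₂ hv₂ σ₂ hσ₂))
      π.toMeasure := by
  refine PoincareInequality.of_mhFlow_le π _ _ (fun ε hε => ?_) h
  obtain ⟨M₁, hM₁⟩ := exists_ae_norm_le_of_essSup_lt_top hb₁
  obtain ⟨M₂, hM₂⟩ := exists_ae_norm_le_of_essSup_lt_top hb₂
  obtain ⟨r, hr⟩ := exists_lintegral_gaussianDensity_le (d := d) hσ₁ hε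
  -- A move of length at most r + M₁ lies within r + M₁ + M₂ of the second proposal mean.
  obtain ⟨C, hC⟩ := exists_gaussianDensity_le_mul (d := d) hσ₁ hσ₂ (r + M₁ + M₂)
  have hpm : Measurable (LebesgueSpace.pos (X := X)) := LebesgueSpace.measurable_pos
  refine ⟨C, {z | r + M₁ < ‖z.1.pos - z.2.pos‖}, measurableSet_lt measurable_const
    ((hpm.comp measurable_fst).sub (hpm.comp measurable_snd)).norm, fun x y hxy => ?_, ?_, ?_⟩
  · rw [Set.mem_ofPred_eq] at hxy ⊢
    rwa [norm_sub_rev]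
  · filter_upwards [hM₁] with x hx
    by_cases h0 : π.dens x = 0
    · simp [mhFlow, h0]
    · calc _ ≤ ∫⁻ y, π.dens x * ({z : LebesgueSpace X × LebesgueSpace X |
            r + M₁ < ‖z.1.pos - z.2.pos‖}.indicator 1 (x, y)
              * ((gaussianProposal X v₁ hv₁ σ₁ hσ₁).dens x y : ℝ≥0∞)) ∂lebesgueOn X := by
            refine lintegral_mono fun y => ?_
            rw [mul_left_comm, ← ENNReal.coe_mul]
            gcongr
            exact min_le_left _ _
        _ = π.dens x * ∫⁻ y, {z : LebesgueSpace X × LebesgueSpace X |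
            r + M₁ < ‖z.1.pos - z.2.pos‖}.indicator 1 (x, y)
              * ((gaussianProposal X v₁ hv₁ σ₁ hσ₁).dens x y : ℝ≥0∞) ∂lebesgueOn X :=
            lintegral_const_mul' _ _ ENNReal.coe_ne_top
        _ ≤ π.dens x * ε := by
            gcongr
            exact (lintegral_gaussianProposal_far_le hv₁ hσ₁ (hx h0)).trans hr
        _ = ε * π.dens x := mul_comm _ _
  · have hdens : ∀ x y : LebesgueSpace X, (π.dens x ≠ 0 → ‖v₂ x‖ ≤ M₂) →
        ‖x.pos - y.pos‖ ≤ r + M₁ →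
        π.dens x * (gaussianProposal X v₁ hv₁ σ₁ hσ₁).dens x y ≤
          C * (π.dens x * (gaussianProposal X v₂ hv₂ σ₂ hσ₂).dens x y) := by
      intro x y hx hxy
      by_cases h0 : π.dens x = 0
      · simp [h0]
      · rw [mul_left_comm]
        gcongr
        refine hC _ _ _ ?_
        rw [← sub_sub]
        refine (norm_sub_le _ _).trans (add_le_add ?_ (hx h0))
        rwa [norm_sub_rev]
    -- The flow is a minimum over a move and its reverse, so the drift bound is needed at both
    -- endpoints.
    filter_upwards [hM₂] with x hx
    filter_upwards [hM₂] with y hy hxy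
    replace hxy := not_lt.1 hxy
    rw [mhFlow, mhFlow, mul_min]
    exact min_le_min (hdens x y hx hxy) (hdens y x hy (by rwa [norm_sub_rev]))

end GaussianComparison

theorem proposition4 {d : ℕ} (X : Set (EuclideanSpace ℝ (Fin d)))
    (hX : NullMeasurableSet X volume)
    (π : TargetDensity (LebesgueSpace X) (lebesgueOn X))
    (v : LebesgueSpace X → EuclideanSpace ℝ (Fin d)) (hv : Measurable v)
    (hv_bdd : essSup (fun x => ‖v x‖ₑ) π.toMeasure < ⊤)
    (lam : ℝ) (hlam : 0 < lam) (σ : ℝ) (hσ : 0 < σ) :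
    VarianceBounding (mhKernel π (rwmProposal X lam hlam)) π.toMeasure ↔
      VarianceBounding (mhKernel π (gaussianProposal X v hv σ hσ)) π.toMeasure := by
  have h0 : essSup (fun _ : LebesgueSpace X => ‖(0 : EuclideanSpace ℝ (Fin d))‖ₑ) π.toMeasure < ⊤ :=
    lt_of_le_of_lt (essSup_le_of_ae_le 0 (Eventually.of_forall fun _ => by simp)) (by simp)
  rw [varianceBounding_iff_poincareInequality (map_swap_compProd_mhKernel π _),
    varianceBounding_iff_poincareInequality (map_swap_compProd_mhKernel π _)]
  -- The random walk is the case of zero drift, and the two directions exchange the roles of the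
  -- proposals.
  exact ⟨fun h => .of_gaussianProposal π measurable_const hv h0 hv_bdd hlam hσ h,
    fun h => .of_gaussianProposal π hv measurable_const hv_bdd h0 hσ hlam h⟩
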